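/- Let $n\ge 2$ and $\sigma>0$, let $\mathbf h=(h_1,\dots,h_n)$ have positive entries with $\sum_{i=1}^n h_i=1$, and let $\boldsymbol\alpha=(\alpha_1,\dots,\alpha_n)\in[0,1]^n$ satisfy $\alpha_1>\alpha_2>\cdots>\alpha_n>0$ and $\alpha_n\le\frac12$. Consider the channel $Y=S+Z$ with $S=\sum_{k=1}^n h_kX_k$, where $Z\sim\mathcal N(0,\sigma^2)$ is independent of the random vector $\mathbf X=(X_1,\dots,X_n)$. Call the law of $\mathbf X$ feasible if $0\le X_k\le 1$ almost surely and $\mathbb E[X_k]\le\alpha_k$ for all $k$, and let $\mathsf C_{\mathrm B}(\mathbf h,\boldsymbol\alpha,\sigma)=\sup I(\mathbf X;Y)$, the supremum being over all feasible laws (mutual information in nats, $\log$ the natural logarithm). For $0\le k\le n$ put $\mathsf H_{[k]}=\sum_{i=1}^k h_i$; for $0\le k\le n-1$ put $\bar\alpha_k=\frac{1}{1-\mathsf H_{[k]}}\sum_{i=k+1}^n h_i\alpha_i$, and put $\bar\alpha_n=0$. For real $\beta$ let $k_\beta=|\{k\in\{1,\dots,n\}:\alpha_k\ge\beta\}|$,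 and let $$\beta^*=\inf\left\{\beta\in(\alpha_n,\alpha_1]:\ \mathsf H_{[k_\beta]}(1-2\beta)-2\left(1-\mathsf H_{[k_\beta]}\right)\bar\alpha_{k_\beta}\le 0\right\},$$ where $\beta^*=\alpha_1$ if this set is empty. For $\mathbf a\in\mathbb R^n$ let $\mathsf V^{\mathrm E}_{\max}(\mathbf h,\mathbf a)=\sum_{i=1}^n\sum_{j=1}^n h_ih_j\left(\min\{a_i,a_j\}-a_ia_j\right)$, and let $$\mathsf V^{\mathrm B}_{\max}(\mathbf h,\boldsymbol\alpha)=\mathsf H_{[k_{\beta^*}]}^2\beta^*(1-\beta^*)+2\mathsf H_{[k_{\beta^*}]}\left(1-\mathsf H_{[k_{\beta^*}]}\right)\bar\alpha_{k_{\beta^*}}(1-\beta^*)+\sum_{i=k_{\beta^*}+1}^{n}\ \sum_{j=k_{\beta^*}+1}^{n}h_ih_j\left(\min\{\alpha_i,\alpha_j\}-\alpha_i\alpha_j\right).$$ Then $$\mathsf C_{\mathrm B}(\mathbf h,\boldsymbol\alpha,\sigma)\le\frac12\log\left(1+\frac{\mathsf V^{\mathrm B}_{\max}(\mathbf h,\boldsymbol\alpha)}{\sigma^2}\right).$$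 Moreover, $\mathsf V^{\mathrm B}_{\max}(\mathbf h,\boldsymbol\alpha)$ is the maximum of the variance of $S$ over all feasible laws of $\mathbf X$; and $\beta^*\in[0,\alpha_1]$, $\mathsf V^{\mathrm B}_{\max}(\mathbf h,\boldsymbol\alpha)=\mathsf V^{\mathrm E}_{\max}(\mathbf h,\min\{\beta^*\mathbf 1,\boldsymbol\alpha\})$ (entrywise minimum), and $\beta^*$ maximizes $\beta\mapsto\mathsf V^{\mathrm E}_{\max}(\mathbf h,\min\{\beta\mathbf 1,\boldsymbol\alpha\})$ over $[0,\alpha_1]$. -/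

import Mathlib

open MeasureTheory ProbabilityTheory
open scoped ENNReal

noncomputable section

namespace OIC

/-- The mutual information `I(X;Y)`, in nats, of a pair with joint law `ρ`: the relative entropy of
`ρ` with respect to the product of its marginals. -/
def mutualInfo {A B : Type*} [MeasurableSpace A] [MeasurableSpace B] (ρ : Measure (A × B)) : ℝ≥0∞ :=
  InformationTheory.klDiv ρ (ρ.fst.prod ρ.snd)

/-- The equivalent scalar input `S = ∑ₖ hₖ xₖ`. -/
def equivInput {n : ℕ} (h : Fin n → ℝ) (x : Fin n → ℝ) : ℝ := ∑ k, h k * x k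

/-- The joint law of `(X, Y)`, where `Y = hᵀX + Z`, the input `X` has law `P`, and `Z ∼ N(0, σ²)` is
independent of `X`. -/
def jointLaw {n : ℕ} (h : Fin n → ℝ) (σ : ℝ) (P : Measure (Fin n → ℝ)) :
    Measure ((Fin n → ℝ) × ℝ) :=
  (P.prod (gaussianReal 0 (Real.toNNReal (σ ^ 2)))).map
    (fun p => (p.1, equivInput h p.1 + p.2))

/-- Input laws satisfying the bounded-cost constraints: `0 ≤ Xₖ ≤ 1` almost surely and
`E[Xₖ] ≤ αₖ` for every transmitter `k`. -/
structure IsFeasibleBC {n : ℕ} (α : Fin n → ℝ) (P : Measure (Fin n → ℝ)) : Prop where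
  isProb : IsProbabilityMeasure P
  peak : ∀ k, ∀ᵐ x ∂P, 0 ≤ x k ∧ x k ≤ 1
  average : ∀ k, ∫ x, x k ∂P ≤ α k

/-- The capacity (in nats) of the bounded-cost constrained channel, the supremum of `I(X;Y)` over all
feasible input laws. -/
def capacityBC {n : ℕ} (h α : Fin n → ℝ) (σ : ℝ) : ℝ≥0∞ :=
  ⨆ (P : Measure (Fin n → ℝ)) (_ : IsFeasibleBC α P), mutualInfo (jointLaw h σ P)

/-- `H_[k] = h₁ + ⋯ + h_k`. Transmitter `i ∈ {1, …, n}` is the element `i - 1` of `Fin n`. -/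
def cumGain {n : ℕ} (h : Fin n → ℝ) (k : ℕ) : ℝ :=
  ∑ i : Fin n with i.val < k, h i

/-- The weighted average `(∑_{i > k} hᵢ αᵢ) / (1 - H_[k])` over the last `n - k` transmitters; it is
`0` for `k = n`. -/
def tailAvg {n : ℕ} (h α : Fin n → ℝ) (k : ℕ) : ℝ :=
  (∑ i : Fin n with k ≤ i.val, h i * α i) / (1 - cumGain h k)

/-- `k_β`, the number of `k` with `αₖ ≥ β`. -/
def levelCount {n : ℕ} (α : Fin n → ℝ) (β : ℝ) : ℕ :=
  (Finset.univ.filter (fun k : Fin n => β ≤ α k)).card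

/-- The levels `β ∈ (αₙ, α₁]` with
`H_[k_β] (1 - 2β) - 2 (1 - H_[k_β]) ᾱ_{k_β} ≤ 0`. -/
def levelSet {n : ℕ} (hn : 2 ≤ n) (h α : Fin n → ℝ) : Set ℝ :=
  {β | β ∈ Set.Ioc (α ⟨n - 1, by omega⟩) (α ⟨0, by omega⟩) ∧
    cumGain h (levelCount α β) * (1 - 2 * β)
      - 2 * (1 - cumGain h (levelCount α β)) * tailAvg h α (levelCount α β) ≤ 0}

/-- `β*`, the infimum of `levelSet`, taken to be `α₁` if that set is empty. As every element of the
set is at most `α₁`, inserting `α₁` changes the infimum only when the set is empty. -/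
def betaStar {n : ℕ} (hn : 2 ≤ n) (h α : Fin n → ℝ) : ℝ :=
  sInf (insert (α ⟨0, by omega⟩) (levelSet hn h α))

/-- `V_max^E(h, a) = ∑ᵢ ∑ⱼ hᵢ hⱼ (min{aᵢ, aⱼ} - aᵢ aⱼ)`. -/
def VmaxE {n : ℕ} (h a : Fin n → ℝ) : ℝ :=
  ∑ i, ∑ j, h i * h j * (min (a i) (a j) - a i * a j)

/-- The explicit formula for `V_max^B(h, α)`, evaluated at `β*`. -/
def VmaxB {n : ℕ} (hn : 2 ≤ n) (h α : Fin n → ℝ) : ℝ :=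
  let β := betaStar hn h α
  let k := levelCount α β
  cumGain h k ^ 2 * β * (1 - β)
    + 2 * cumGain h k * (1 - cumGain h k) * tailAvg h α k * (1 - β)
    + ∑ i : Fin n with k ≤ i.val, ∑ j : Fin n with k ≤ j.val,
        h i * h j * (min (α i) (α j) - α i * α j)

end OIC

end

/-!
Two facts are combined: a Gaussian bound on `I(X;Y)` in terms of the variance of `S`, and the
determination of the largest variance of `S`.

For the first, by the chain rule for the relative entropy, `I(X;Y)` is at most the relative entropy
of the joint law with respect to the product of the input law and any law on the output space
(`mutualInfo_le_klDiv_prod`). If that law is the Gaussian with the mean and variance of `Y`, this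
relative entropy equals `1/2 log (1 + Var S / σ²)` (`klDiv_jointLaw_prod_gaussianReal`).

For the second, among inputs in `[0, 1]` with means `a`, the variance of `S` is largest, with value
`VmaxE h a`, for the nested input `Xₖ = 1{U ≤ aₖ}` with `U` uniform, because `Xᵢ Xⱼ ≤ min Xᵢ Xⱼ`
(`IsFeasibleBC.variance_le_VmaxE`, `variance_map_nestedInput`). It remains to maximize `VmaxE h a`
over `0 ≤ a ≤ α`. As a function of the value `u` of `U`, the sum `S` for the nested input with means
`a` lies between `0` and its value `H(u)` for `a = α`. Let `c = ∑ hₖ min(β*, αₖ)`. The variance is at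
most the mean of `(S - c)²`, and for each `u` the square is at most `max (c², (H(u) - c)²)`. The
definition of `β*` amounts to `H(u) ≥ 2c` for `u < β*` and `H(u) ≤ 2c` for `u > β*`
(`betaStar_spec`); so this maximum is attained by `S = H(u)` for `u < β*` and by `S = 0` for
`u > β*`. That is exactly the nested input with means `min(β*, αₖ)`, for which `E[S] = c`
(`VmaxE_le_VmaxE_min`). The case `u < β* = αₙ` is the one that uses `αₙ ≤ 1/2`.
-/

namespace OIC

/-! ### The Gaussian bound on mutual information -/

lemma klDiv_map_swap {A B : Type*} [MeasurableSpace A] [MeasurableSpace B]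
    (μ ν : Measure (A × B)) [IsFiniteMeasure μ] [IsFiniteMeasure ν] :
    InformationTheory.klDiv (μ.map Prod.swap) (ν.map Prod.swap)
      = InformationTheory.klDiv μ ν := by
  refine le_antisymm (InformationTheory.klDiv_map_le μ ν measurable_swap) ?_
  have h := InformationTheory.klDiv_map_le (μ.map Prod.swap) (ν.map Prod.swap) measurable_swap
  simpa [Measure.map_map measurable_swap measurable_swap, Prod.swap_swap_eq] using h

/-- Replacing the output marginal by any other law can only increase the relative entropy: by the
chain rule the excess is `klDiv ρ.snd R`. -/
lemma mutualInfo_le_klDiv_prod {A B : Type*} [MeasurableSpace A] [MeasurableSpace B]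
    [StandardBorelSpace A] [Nonempty A] (ρ : Measure (A × B)) [IsProbabilityMeasure ρ]
    (R : Measure B) [IsProbabilityMeasure R] :
    mutualInfo ρ ≤ InformationTheory.klDiv ρ (ρ.fst.prod R) := by
  set τ : Measure (B × A) := ρ.map Prod.swap with hτ
  have : IsProbabilityMeasure τ := Measure.isProbabilityMeasure_map measurable_swap.aemeasurable
  have hfst : τ.fst = ρ.snd := Measure.fst_map_swap
  have hdis : τ = τ.fst ⊗ₘ τ.condKernel := (τ.disintegrate τ.condKernel).symm
  unfold mutualInfo
  rw [← klDiv_map_swap ρ, ← klDiv_map_swap ρ (ρ.fst.prod R), Measure.prod_swap, Measure.prod_swap,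
    ← hτ, ← hfst, ← Measure.compProd_const, ← Measure.compProd_const]
  have key := InformationTheory.klDiv_compProd_eq_add τ.fst R τ.condKernel (Kernel.const B ρ.fst)
  rw [← hdis] at key
  rw [key]
  exact le_add_self

variable {n : ℕ} {h : Fin n → ℝ} {σ : ℝ} {P : Measure (Fin n → ℝ)}

lemma measurable_equivInput (h : Fin n → ℝ) : Measurable (equivInput h) := by
  unfold equivInput
  fun_prop

lemma measurable_channel (h : Fin n → ℝ) :
    Measurable (fun p : (Fin n → ℝ) × ℝ => (p.1, equivInput h p.1 + p.2)) :=
  measurable_fst.prodMk (((measurable_equivInput h).comp measurable_fst).add measurable_snd)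

lemma fst_jointLaw [IsProbabilityMeasure P] : (jointLaw h σ P).fst = P := by
  rw [jointLaw, Measure.fst, Measure.map_map measurable_fst (measurable_channel h)]
  exact Measure.fst_prod

/-- The joint law has the expected Gaussian likelihood ratio with respect to the product of the
input law with a reference Gaussian. -/
lemma jointLaw_eq_withDensity [IsProbabilityMeasure P] (hσ : 0 < σ) (m : ℝ) {v : NNReal}
    (hv : v ≠ 0) :
    jointLaw h σ P = (P.prod (gaussianReal m v)).withDensity (fun p =>
      gaussianPDF (equivInput h p.1) (Real.toNNReal (σ ^ 2)) p.2 / gaussianPDF m v p.2) := by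
  have hs : Real.toNNReal (σ ^ 2) ≠ 0 := by
    rw [ne_eq, Real.toNNReal_eq_zero, not_le]; positivity
  have hmeas : Measurable (fun p : (Fin n → ℝ) × ℝ =>
      gaussianPDF (equivInput h p.1) (Real.toNNReal (σ ^ 2)) p.2 / gaussianPDF m v p.2) := by
    refine Measurable.div ?_ ((measurable_gaussianPDF m v).comp measurable_snd)
    exact measurable_uncurry_gaussianPDF.comp
      (((measurable_equivInput h).comp measurable_fst).prodMk
        (measurable_const.prodMk measurable_snd))
  ext A hA
  rw [jointLaw, Measure.map_apply (measurable_channel h) hA,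
    Measure.prod_apply (measurable_channel h hA), withDensity_apply _ hA,
    ← lintegral_indicator hA, lintegral_prod _ (hmeas.indicator hA).aemeasurable]
  refine lintegral_congr fun x => ?_
  have hAx : MeasurableSet (Prod.mk x ⁻¹' A) := measurable_prodMk_left hA
  have h1 : gaussianReal 0 (Real.toNNReal (σ ^ 2))
      (Prod.mk x ⁻¹' ((fun p : (Fin n → ℝ) × ℝ => (p.1, equivInput h p.1 + p.2)) ⁻¹' A))
      = gaussianReal (equivInput h x) (Real.toNNReal (σ ^ 2)) (Prod.mk x ⁻¹' A) := by
    have := gaussianReal_map_const_add (μ := 0) (v := Real.toNNReal (σ ^ 2)) (equivInput h x)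
    rw [zero_add] at this
    rw [← this, Measure.map_apply (by fun_prop) hAx]
    rfl
  rw [h1, gaussianReal_apply _ hs, gaussianReal_of_var_ne_zero m hv,
    lintegral_withDensity_eq_lintegral_mul (g := fun y => A.indicator _ (x, y)) _
      (measurable_gaussianPDF m v) ((hmeas.indicator hA).comp measurable_prodMk_left),
    ← lintegral_indicator hAx]
  refine lintegral_congr fun y => ?_
  by_cases hy : (x, y) ∈ A
  · rw [Set.indicator_of_mem (show y ∈ Prod.mk x ⁻¹' A from hy)]
    simp only [Pi.mul_apply, Set.indicator_of_mem hy]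
    rw [ENNReal.mul_div_cancel (gaussianPDF_pos m hv y).ne' gaussianPDF_ne_top]
  · rw [Set.indicator_of_notMem (show y ∉ Prod.mk x ⁻¹' A from hy)]
    simp [Set.indicator_of_notMem hy]

lemma log_gaussianPDF_div {s w : NNReal} (hs : s ≠ 0) (hw : w ≠ 0) (a m y : ℝ) :
    Real.log (gaussianPDF a s y / gaussianPDF m w y).toReal
      = 1 / 2 * Real.log (w / s) - (y - a) ^ 2 / (2 * s) + (y - m) ^ 2 / (2 * w) := by
  have hs' : (0 : ℝ) < s := by positivity
  have hw' : (0 : ℝ) < w := by positivity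
  have hlog : ∀ (t : NNReal) (_ : (0 : ℝ) < t) (b : ℝ), Real.log (gaussianPDFReal b t y)
      = -(1 / 2 * Real.log (2 * Real.pi * t)) - (y - b) ^ 2 / (2 * t) := by
    intro t ht b
    rw [gaussianPDFReal, Real.log_mul (by positivity) (Real.exp_pos _).ne', Real.log_exp,
      Real.log_inv, Real.log_sqrt (by positivity)]
    ring
  rw [ENNReal.toReal_div, toReal_gaussianPDF, toReal_gaussianPDF,
    Real.log_div (gaussianPDFReal_pos a s y hs).ne' (gaussianPDFReal_pos m w y hw).ne',
    hlog s hs' a, hlog w hw' m, Real.log_div hw'.ne' hs'.ne',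
    Real.log_mul (by positivity) hs'.ne', Real.log_mul (by positivity) hw'.ne']
  ring

/-- The relative entropy of the joint law with respect to the product of the input law and the
Gaussian with the mean and variance of the output. -/
lemma klDiv_jointLaw_prod_gaussianReal [IsProbabilityMeasure P] (hσ : 0 < σ)
    (hS : MemLp (equivInput h) 2 P) :
    InformationTheory.klDiv (jointLaw h σ P) (P.prod (gaussianReal (∫ x, equivInput h x ∂P)
        (Real.toNNReal (σ ^ 2 + variance (equivInput h) P))))
      = ENNReal.ofReal (1 / 2 * Real.log (1 + variance (equivInput h) P / σ ^ 2)) := by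
  set V := variance (equivInput h) P with hVdef
  set m := ∫ x, equivInput h x ∂P with hm
  set s : NNReal := Real.toNNReal (σ ^ 2) with hsdef
  set w : NNReal := Real.toNNReal (σ ^ 2 + V) with hwdef
  have hV : 0 ≤ V := variance_nonneg _ _
  have hσ2 : 0 < σ ^ 2 := by positivity
  have hsr : (s : ℝ) = σ ^ 2 := Real.coe_toNNReal _ hσ2.le
  have hwr : (w : ℝ) = σ ^ 2 + V := Real.coe_toNNReal _ (by positivity)
  have hs : s ≠ 0 := by rw [hsdef, ne_eq, Real.toNNReal_eq_zero, not_le]; exact hσ2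
  have hw : w ≠ 0 := by rw [hwdef, ne_eq, Real.toNNReal_eq_zero, not_le]; positivity
  have hprob : IsProbabilityMeasure (jointLaw h σ P) :=
    Measure.isProbabilityMeasure_map (measurable_channel h).aemeasurable
  have hdens := jointLaw_eq_withDensity (h := h) (P := P) hσ m hw
  have hmeas : Measurable (fun p : (Fin n → ℝ) × ℝ =>
      gaussianPDF (equivInput h p.1) s p.2 / gaussianPDF m w p.2) := by
    refine Measurable.div ?_ ((measurable_gaussianPDF m w).comp measurable_snd)
    exact measurable_uncurry_gaussianPDF.comp
      (((measurable_equivInput h).comp measurable_fst).prodMk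
        (measurable_const.prodMk measurable_snd))
  have hac : jointLaw h σ P ≪ P.prod (gaussianReal m w) := by
    rw [hdens]; exact withDensity_absolutelyContinuous _ _
  have hllr : llr (jointLaw h σ P) (P.prod (gaussianReal m w)) =ᵐ[jointLaw h σ P] fun p =>
      1 / 2 * Real.log (w / s) - (p.2 - equivInput h p.1) ^ 2 / (2 * s)
        + (p.2 - m) ^ 2 / (2 * w) := by
    have h1 := Measure.rnDeriv_withDensity (P.prod (gaussianReal m w)) hmeas
    rw [← hdens] at h1
    filter_upwards [hac.ae_le h1] with p hp
    rw [llr, hp, log_gaussianPDF_div hs hw]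
  have hmeasL : Measurable (fun p : (Fin n → ℝ) × ℝ =>
      1 / 2 * Real.log (w / s) - (p.2 - equivInput h p.1) ^ 2 / (2 * s)
        + (p.2 - m) ^ 2 / (2 * w)) := by
    have := measurable_equivInput h
    fun_prop
  -- In the coordinates `(x, z)` the likelihood ratio is a quadratic polynomial in `z` and `S - m`.
  have hexp : (fun p : (Fin n → ℝ) × ℝ =>
      1 / 2 * Real.log (w / s) - (p.2 - equivInput h p.1) ^ 2 / (2 * s)
        + (p.2 - m) ^ 2 / (2 * w)) ∘ (fun p => (p.1, equivInput h p.1 + p.2))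
      = fun p : (Fin n → ℝ) × ℝ => 1 / 2 * Real.log (w / s) + ((1 / (2 * w) - 1 / (2 * s)) * p.2 ^ 2
        + ((1 / (2 * w)) * (equivInput h p.1 - m) ^ 2
          + (1 / w) * ((equivInput h p.1 - m) * p.2))) := by
    funext p
    simp only [Function.comp]
    ring
  have hSm : MemLp (fun x => equivInput h x - m) 2 P := hS.sub (memLp_const m)
  have hZ : MemLp (fun z : ℝ => z) 2 (gaussianReal 0 s) := memLp_id_gaussianReal 2
  have hZ1 : Integrable (fun z : ℝ => z) (gaussianReal 0 s) := hZ.integrable one_le_two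
  have hZ2 : Integrable (fun z : ℝ => z ^ 2) (gaussianReal 0 s) := hZ.integrable_sq
  have i1 : Integrable (fun p : (Fin n → ℝ) × ℝ => p.2 ^ 2) (P.prod (gaussianReal 0 s)) :=
    hZ2.comp_snd P
  have i2 : Integrable (fun p : (Fin n → ℝ) × ℝ => (equivInput h p.1 - m) ^ 2)
      (P.prod (gaussianReal 0 s)) := hSm.integrable_sq.comp_fst _
  have i3 : Integrable (fun p : (Fin n → ℝ) × ℝ => (equivInput h p.1 - m) * p.2)
      (P.prod (gaussianReal 0 s)) := (hSm.integrable one_le_two).mul_prod hZ1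
  have hEZ2 : ∫ z, z ^ 2 ∂(gaussianReal 0 s) = σ ^ 2 := by
    have h1 := variance_fun_id_gaussianReal (μ := 0) (v := s)
    rw [variance_eq_integral (by fun_prop)] at h1
    simpa [integral_id_gaussianReal, hsr] using h1
  have hES2 : ∫ x, (equivInput h x - m) ^ 2 ∂P = V :=
    (variance_eq_integral (measurable_equivInput h).aemeasurable).symm
  have e1 : ∫ p, p.2 ^ 2 ∂(P.prod (gaussianReal 0 s)) = σ ^ 2 := by
    rw [integral_fun_snd (fun z : ℝ => z ^ 2), hEZ2]; simp
  have e2 : ∫ p, (equivInput h p.1 - m) ^ 2 ∂(P.prod (gaussianReal 0 s)) = V := by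
    rw [integral_fun_fst (fun x => (equivInput h x - m) ^ 2), hES2]; simp
  have e3 : ∫ p, (equivInput h p.1 - m) * p.2 ∂(P.prod (gaussianReal 0 s)) = 0 := by
    rw [integral_prod_mul (fun x => equivInput h x - m) (fun z : ℝ => z),
      integral_id_gaussianReal, mul_zero]
  have i23 : Integrable (fun p : (Fin n → ℝ) × ℝ =>
      (1 / (2 * w)) * (equivInput h p.1 - m) ^ 2 + (1 / w) * ((equivInput h p.1 - m) * p.2))
      (P.prod (gaussianReal 0 s)) := (i2.const_mul _).add (i3.const_mul _)
  have i123 : Integrable (fun p : (Fin n → ℝ) × ℝ => (1 / (2 * w) - 1 / (2 * s)) * p.2 ^ 2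
      + ((1 / (2 * w)) * (equivInput h p.1 - m) ^ 2
        + (1 / w) * ((equivInput h p.1 - m) * p.2)))
      (P.prod (gaussianReal 0 s)) := (i1.const_mul _).add i23
  have hint : Integrable (llr (jointLaw h σ P) (P.prod (gaussianReal m w))) (jointLaw h σ P) := by
    rw [integrable_congr hllr, jointLaw,
      integrable_map_measure hmeasL.aestronglyMeasurable (measurable_channel h).aemeasurable, hexp]
    exact (integrable_const _).add i123
  have hval : ∫ p, llr (jointLaw h σ P) (P.prod (gaussianReal m w)) p ∂(jointLaw h σ P)
      = 1 / 2 * Real.log (w / s) + ((1 / (2 * w) - 1 / (2 * s)) * σ ^ 2 + 1 / (2 * w) * V) := by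
    rw [integral_congr_ae hllr, jointLaw,
      integral_map (measurable_channel h).aemeasurable hmeasL.aestronglyMeasurable]
    refine (integral_congr_ae (.of_forall fun p => congrFun hexp p)).trans ?_
    rw [integral_add (integrable_const _) i123, integral_add (i1.const_mul _) i23,
      integral_add (i2.const_mul _) (i3.const_mul _), integral_const, integral_const_mul,
      integral_const_mul, integral_const_mul, e1, e2, e3]
    simp
  rw [InformationTheory.klDiv_of_ac_of_integrable hac hint, hval]
  congr 1
  simp only [probReal_univ, hsr, hwr]
  have hlog : (σ ^ 2 + V) / σ ^ 2 = 1 + V / σ ^ 2 := by field_simp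
  rw [hlog]
  have : σ ^ 2 + V ≠ 0 := by positivity
  field_simp
  ring

/-- For a given variance of the equivalent input, the mutual information is at most that of a
Gaussian input. -/
lemma mutualInfo_jointLaw_le [IsProbabilityMeasure P] (hσ : 0 < σ)
    (hS : MemLp (equivInput h) 2 P) :
    mutualInfo (jointLaw h σ P)
      ≤ ENNReal.ofReal (1 / 2 * Real.log (1 + variance (equivInput h) P / σ ^ 2)) := by
  have : IsProbabilityMeasure (jointLaw h σ P) :=
    Measure.isProbabilityMeasure_map (measurable_channel h).aemeasurable
  rw [← klDiv_jointLaw_prod_gaussianReal hσ hS]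
  convert! mutualInfo_le_klDiv_prod (jointLaw h σ P) _
  · exact fst_jointLaw.symm
  · infer_instance

/-! ### The nested binary input with prescribed means -/

variable {α a : Fin n → ℝ}

/-- The uniform law on `(0, 1]`. -/
noncomputable def unifLaw : Measure ℝ := volume.restrict (Set.Ioc 0 1)

instance : IsProbabilityMeasure unifLaw := ⟨by simp [unifLaw]⟩

/-- The input `Xₖ = 1{U ≤ aₖ}` as a function of the value `u` of `U`. For `U` uniform it has means
`aₖ` and the largest covariances that inputs in `[0, 1]` with these means can have. -/
noncomputable def nestedInput (a : Fin n → ℝ) (u : ℝ) : Fin n → ℝ :=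
  fun k => if u ≤ a k then 1 else 0

lemma nestedInput_mem_Icc (a : Fin n → ℝ) (u : ℝ) (k : Fin n) :
    nestedInput a u k ∈ Set.Icc (0 : ℝ) 1 := by
  unfold nestedInput
  split_ifs <;> simp

lemma measurable_nestedInput_apply (a : Fin n → ℝ) (k : Fin n) :
    Measurable (fun u => nestedInput a u k) :=
  Measurable.ite measurableSet_Iic measurable_const measurable_const

lemma measurable_nestedInput (a : Fin n → ℝ) : Measurable (nestedInput a) :=
  measurable_pi_iff.mpr (measurable_nestedInput_apply a)

lemma memLp_two_of_mem_Icc {Ω : Type*} [MeasurableSpace Ω] {μ : Measure Ω} [IsFiniteMeasure μ]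
    {f : Ω → ℝ} (hf : AEStronglyMeasurable f μ) (h01 : ∀ᵐ ω ∂μ, 0 ≤ f ω ∧ f ω ≤ 1) :
    MemLp f 2 μ := by
  refine MemLp.of_bound hf 1 ?_
  filter_upwards [h01] with ω hω
  rw [Real.norm_eq_abs, abs_of_nonneg hω.1]
  exact hω.2

lemma memLp_nestedInput_apply (a : Fin n → ℝ) (k : Fin n) :
    MemLp (fun u => nestedInput a u k) 2 unifLaw :=
  memLp_two_of_mem_Icc (measurable_nestedInput_apply a k).aestronglyMeasurable
    (.of_forall fun u => nestedInput_mem_Icc a u k)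

lemma integral_ite_le_unifLaw {c : ℝ} (hc : c ∈ Set.Icc (0 : ℝ) 1) :
    ∫ u, (if u ≤ c then (1 : ℝ) else 0) ∂unifLaw = c := by
  have h1 : (fun u : ℝ => if u ≤ c then (1 : ℝ) else 0) = (Set.Iic c).indicator 1 := by
    funext u
    simp [Set.indicator_apply]
  rw [h1, integral_indicator_one measurableSet_Iic, unifLaw, measureReal_restrict_apply
    measurableSet_Iic, Set.inter_comm, Set.Ioc_inter_Iic, min_eq_right hc.2, Real.volume_real_Ioc,
    sub_zero, max_eq_left hc.1]

lemma integral_nestedInput_apply (ha : ∀ k, a k ∈ Set.Icc (0 : ℝ) 1) (k : Fin n) :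
    ∫ u, nestedInput a u k ∂unifLaw = a k :=
  integral_ite_le_unifLaw (ha k)

lemma covariance_nestedInput (ha : ∀ k, a k ∈ Set.Icc (0 : ℝ) 1) (i j : Fin n) :
    covariance (fun u => nestedInput a u i) (fun u => nestedInput a u j) unifLaw
      = min (a i) (a j) - a i * a j := by
  rw [covariance_eq_sub (memLp_nestedInput_apply a i) (memLp_nestedInput_apply a j),
    integral_nestedInput_apply ha, integral_nestedInput_apply ha]
  congr 1
  have : (fun u => nestedInput a u i) * (fun u => nestedInput a u j)
      = fun u => if u ≤ min (a i) (a j) then (1 : ℝ) else 0 := by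
    funext u
    by_cases h1 : u ≤ a i <;> by_cases h2 : u ≤ a j <;> simp [nestedInput, h1, h2]
  rw [this]
  exact integral_ite_le_unifLaw ⟨le_min (ha i).1 (ha j).1, (min_le_left _ _).trans (ha i).2⟩

/-! ### Variances of the equivalent input -/

lemma memLp_equivInput {Ω : Type*} [MeasurableSpace Ω] {μ : Measure Ω} {X : Ω → Fin n → ℝ}
    (hX : ∀ k, MemLp (fun ω => X ω k) 2 μ) :
    MemLp (fun ω => equivInput h (X ω)) 2 μ := by
  unfold equivInput
  exact memLp_finsetSum _ fun k _ => (hX k).const_mul (h k)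

lemma variance_equivInput {Ω : Type*} [MeasurableSpace Ω] {μ : Measure Ω} [IsFiniteMeasure μ]
    {X : Ω → Fin n → ℝ} (hX : ∀ k, MemLp (fun ω => X ω k) 2 μ) :
    variance (fun ω => equivInput h (X ω)) μ
      = ∑ i, ∑ j, h i * h j * covariance (fun ω => X ω i) (fun ω => X ω j) μ := by
  unfold equivInput
  rw [variance_fun_sum fun k => (hX k).const_mul (h k)]
  refine Finset.sum_congr rfl fun i _ => Finset.sum_congr rfl fun j _ => ?_
  rw [covariance_const_mul_left, covariance_const_mul_right]
  ring

lemma memLp_equivInput_nestedInput (h a : Fin n → ℝ) :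
    MemLp (fun u => equivInput h (nestedInput a u)) 2 unifLaw :=
  memLp_equivInput (memLp_nestedInput_apply a)

lemma integral_equivInput_nestedInput (ha : ∀ k, a k ∈ Set.Icc (0 : ℝ) 1) :
    ∫ u, equivInput h (nestedInput a u) ∂unifLaw = equivInput h a := by
  unfold equivInput
  rw [integral_finsetSum _ fun k _ =>
    ((memLp_nestedInput_apply a k).integrable one_le_two).const_mul (h k)]
  simp_rw [integral_const_mul, integral_nestedInput_apply ha]

lemma variance_equivInput_nestedInput (ha : ∀ k, a k ∈ Set.Icc (0 : ℝ) 1) :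
    variance (fun u => equivInput h (nestedInput a u)) unifLaw = VmaxE h a := by
  rw [variance_equivInput (memLp_nestedInput_apply a)]
  simp_rw [covariance_nestedInput ha, VmaxE]

namespace IsFeasibleBC

lemma memLp_apply (hP : IsFeasibleBC α P) (k : Fin n) : MemLp (fun x => x k) 2 P := by
  have := hP.isProb
  exact memLp_two_of_mem_Icc (measurable_pi_apply k).aestronglyMeasurable (hP.peak k)

lemma memLp_equivInput (hP : IsFeasibleBC α P) : MemLp (equivInput h) 2 P :=
  OIC.memLp_equivInput (X := fun x => x) hP.memLp_apply

lemma mean_nonneg (hP : IsFeasibleBC α P) (k : Fin n) : 0 ≤ ∫ x, x k ∂P :=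
  integral_nonneg_of_ae ((hP.peak k).mono fun _ hx => hx.1)

/-- Inputs in `[0, 1]` satisfy `Xᵢ Xⱼ ≤ min Xᵢ Xⱼ`, so the variance of `S` is bounded by that of the
nested binary input with the same means. -/
lemma variance_le_VmaxE (hP : IsFeasibleBC α P) (hpos : ∀ k, 0 < h k) :
    variance (equivInput h) P ≤ VmaxE h (fun k => ∫ x, x k ∂P) := by
  have := hP.isProb
  have hmul : ∀ i j, ∫ x, x i * x j ∂P ≤ ∫ x, x i ∂P := fun i j => by
    refine integral_mono_ae ((hP.memLp_apply i).integrable_mul (hP.memLp_apply j))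
      ((hP.memLp_apply i).integrable one_le_two) ?_
    filter_upwards [hP.peak i, hP.peak j] with x hi hj
    exact mul_le_of_le_one_right hi.1 hj.2
  have key := variance_equivInput (h := h) (X := fun x => x) hP.memLp_apply
  refine key.trans_le (Finset.sum_le_sum fun i _ => Finset.sum_le_sum fun j _ => ?_)
  refine mul_le_mul_of_nonneg_left ?_ (mul_pos (hpos i) (hpos j)).le
  rw [covariance_eq_sub (hP.memLp_apply i) (hP.memLp_apply j)]
  refine sub_le_sub_right (le_min (hmul i j) ?_) _
  simpa only [Pi.mul_apply, mul_comm] using hmul j i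

end IsFeasibleBC

lemma isFeasibleBC_map_nestedInput (ha : ∀ k, a k ∈ Set.Icc (0 : ℝ) 1) (hle : ∀ k, a k ≤ α k) :
    IsFeasibleBC α (unifLaw.map (nestedInput a)) where
  isProb := Measure.isProbabilityMeasure_map (measurable_nestedInput a).aemeasurable
  peak k := by
    exact (ae_map_iff (p := fun x : Fin n → ℝ => 0 ≤ x k ∧ x k ≤ 1)
      (measurable_nestedInput a).aemeasurable
      (measurableSet_Icc.preimage (measurable_pi_apply k))).mpr
      (.of_forall fun u => nestedInput_mem_Icc a u k)
  average k := by
    rw [integral_map (measurable_nestedInput a).aemeasurable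
      (measurable_pi_apply k).aestronglyMeasurable, integral_nestedInput_apply ha]
    exact hle k

lemma variance_map_nestedInput (ha : ∀ k, a k ∈ Set.Icc (0 : ℝ) 1) :
    variance (equivInput h) (unifLaw.map (nestedInput a)) = VmaxE h a := by
  rw [variance_map (measurable_equivInput h).aemeasurable (measurable_nestedInput a).aemeasurable]
  exact variance_equivInput_nestedInput ha

/-! ### Optimality of a capped mean vector -/

lemma equivInput_nestedInput_nonneg (hpos : ∀ k, 0 < h k) (u : ℝ) :
    0 ≤ equivInput h (nestedInput a u) :=
  Finset.sum_nonneg fun k _ => mul_nonneg (hpos k).le (nestedInput_mem_Icc a u k).1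

lemma equivInput_nestedInput_mono (hpos : ∀ k, 0 < h k) {u v : ℝ} {b : Fin n → ℝ}
    (huv : v ≤ u) (hab : ∀ k, a k ≤ b k) :
    equivInput h (nestedInput a u) ≤ equivInput h (nestedInput b v) := by
  refine Finset.sum_le_sum fun k _ => mul_le_mul_of_nonneg_left ?_ (hpos k).le
  unfold nestedInput
  split_ifs with h1 h2 <;> first | exact absurd (huv.trans (h1.trans (hab k))) h2 | norm_num

/-- Suppose the total gain of the levels above `u` is at least twice the mean `c` of the capped
input for `u < β` and at most `2c` for `u > β`. A nested input with means below `α` takes at `u` a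
value between `0` and that gain, and `(s - c)²` is largest there at the upper end for `u < β` and at
`0` for `u > β`; these are the values of the input with means `min β α`, whose variance is
therefore the largest. -/
lemma VmaxE_le_VmaxE_min (hpos : ∀ k, 0 < h k) (hα : ∀ k, α k ∈ Set.Icc (0 : ℝ) 1) {β : ℝ}
    (hβ : 0 ≤ β)
    (hlt : ∀ u < β, 2 * equivInput h (fun k => min β (α k)) ≤ equivInput h (nestedInput α u))
    (hgt : ∀ u, β < u → equivInput h (nestedInput α u) ≤ 2 * equivInput h (fun k => min β (α k)))
    (ha : ∀ k, 0 ≤ a k) (haα : ∀ k, a k ≤ α k) :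
    VmaxE h a ≤ VmaxE h (fun k => min β (α k)) := by
  set b : Fin n → ℝ := fun k => min β (α k) with hb
  set c := equivInput h b with hc
  have ha1 : ∀ k, a k ∈ Set.Icc (0 : ℝ) 1 := fun k => ⟨ha k, (haα k).trans (hα k).2⟩
  have hb1 : ∀ k, b k ∈ Set.Icc (0 : ℝ) 1 := fun k =>
    ⟨le_min hβ (hα k).1, (min_le_right _ _).trans (hα k).2⟩
  have hLa := memLp_equivInput_nestedInput h a
  have hLb := memLp_equivInput_nestedInput h b
  have hva : VmaxE h a ≤ ∫ u, (equivInput h (nestedInput a u) - c) ^ 2 ∂unifLaw := by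
    rw [← variance_equivInput_nestedInput ha1, ← variance_sub_const hLa.1 c]
    exact variance_le_expectation_sq (hLa.sub (memLp_const c)).1
  have hvb : VmaxE h b = ∫ u, (equivInput h (nestedInput b u) - c) ^ 2 ∂unifLaw := by
    rw [← variance_equivInput_nestedInput hb1, variance_eq_integral hLb.1.aemeasurable,
      integral_equivInput_nestedInput hb1]
  rw [hvb]
  refine hva.trans (integral_mono_ae (hLa.sub (memLp_const c)).integrable_sq
    (hLb.sub (memLp_const c)).integrable_sq ?_)
  have hne : ∀ᵐ u ∂unifLaw, u ≠ β := ae_restrict_of_ae (Measure.ae_ne volume β)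
  filter_upwards [hne] with u hu
  have h0 := equivInput_nestedInput_nonneg (a := a) hpos u
  have hle : equivInput h (nestedInput a u) ≤ equivInput h (nestedInput α u) :=
    equivInput_nestedInput_mono hpos le_rfl haα
  rcases lt_or_gt_of_ne hu with hu | hu
  · have hbu : nestedInput b u = nestedInput α u := by
      funext k
      simp [nestedInput, hb, hu.le]
    rw [hbu]
    have := hlt u hu
    nlinarith
  · have hbu : equivInput h (nestedInput b u) = 0 := by
      refine Finset.sum_eq_zero fun k _ => ?_
      simp [nestedInput, hb, hu]
    rw [hbu]
    have := hgt u hu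
    nlinarith

/-! ### The threshold level -/

lemma lt_levelCount_iff (hanti : StrictAnti α) (β : ℝ) (i : Fin n) :
    i.val < levelCount α β ↔ β ≤ α i := by
  unfold levelCount
  constructor
  · intro hi
    by_contra! hlt
    refine hi.not_ge ?_
    calc _ ≤ (Finset.Iio i).card := Finset.card_le_card fun k hk => by
            rw [Finset.mem_Iio]
            by_contra! hik
            exact (((Finset.mem_filter.mp hk).2.trans (hanti.antitone hik)).trans_lt hlt).false
      _ = i.val := Fin.card_Iio i
  · intro hi
    calc i.val < (Finset.Iic i).card := by simp
      _ ≤ _ := Finset.card_le_card fun k hk => by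
            simpa using hi.trans (hanti.antitone (Finset.mem_Iic.mp hk))

lemma cumGain_levelCount (hanti : StrictAnti α) (β : ℝ) :
    cumGain h (levelCount α β) = equivInput h (nestedInput α β) := by
  unfold cumGain equivInput nestedInput
  simp only [lt_levelCount_iff hanti, Finset.sum_filter, mul_ite, mul_one, mul_zero]

/-- If `k = n`, both sides vanish, in spite of the division by `0` in `tailAvg`. -/
lemma one_sub_cumGain_mul_tailAvg (hpos : ∀ k, 0 < h k) (hsum : ∑ k, h k = 1) (k : ℕ) :
    (1 - cumGain h k) * tailAvg h α k = ∑ i : Fin n with k ≤ i.val, h i * α i := by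
  have h1 : 1 - cumGain h k = ∑ i : Fin n with k ≤ i.val, h i := by
    rw [← hsum, cumGain,
      ← Finset.sum_filter_add_sum_filter_not Finset.univ (fun i : Fin n => i.val < k)]
    simp
  rcases (Finset.univ.filter fun i : Fin n => k ≤ i.val).eq_empty_or_nonempty with he | hne
  · rw [h1, he]
    simp
  · rw [tailAvg, mul_div_cancel₀]
    rw [h1]
    exact (Finset.sum_pos (fun i _ => hpos i) hne).ne'

lemma equivInput_min (hanti : StrictAnti α) (hpos : ∀ k, 0 < h k) (hsum : ∑ k, h k = 1) (β : ℝ) :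
    equivInput h (fun k => min β (α k)) = cumGain h (levelCount α β) * β
      + (1 - cumGain h (levelCount α β)) * tailAvg h α (levelCount α β) := by
  rw [one_sub_cumGain_mul_tailAvg hpos hsum, cumGain, Finset.sum_mul, equivInput,
    ← Finset.sum_filter_add_sum_filter_not Finset.univ (fun i : Fin n => i.val < levelCount α β)]
  congr 1
  · refine Finset.sum_congr rfl fun i hi => ?_
    rw [min_eq_left ((lt_levelCount_iff hanti β i).mp (Finset.mem_filter.mp hi).2)]
  · refine Finset.sum_congr (by simp) fun i hi => ?_
    have : α i < β := by
      rw [← not_le, ← lt_levelCount_iff hanti, not_lt]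
      exact (Finset.mem_filter.mp hi).2
    rw [min_eq_right this.le]

lemma mem_levelSet_iff (hn : 2 ≤ n) (hanti : StrictAnti α) (hpos : ∀ k, 0 < h k)
    (hsum : ∑ k, h k = 1) (β : ℝ) :
    β ∈ levelSet hn h α ↔ β ∈ Set.Ioc (α ⟨n - 1, by omega⟩) (α ⟨0, by omega⟩) ∧
      equivInput h (nestedInput α β) ≤ 2 * equivInput h (fun k => min β (α k)) := by
  rw [equivInput_min hanti hpos hsum, ← cumGain_levelCount hanti, levelSet, Set.mem_ofPred_eq]
  refine and_congr_right fun _ => ?_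
  rw [← sub_nonpos (b := 2 * _)]
  ring_nf

/-- The double sum for the capped means, split according to whether `αᵢ ≥ β` and `αⱼ ≥ β`. -/
lemma VmaxE_min (hanti : StrictAnti α) (hpos : ∀ k, 0 < h k) (hsum : ∑ k, h k = 1) (β : ℝ) :
    VmaxE h (fun k => min β (α k)) =
      cumGain h (levelCount α β) ^ 2 * β * (1 - β)
        + 2 * cumGain h (levelCount α β) * (1 - cumGain h (levelCount α β))
          * tailAvg h α (levelCount α β) * (1 - β)
        + ∑ i : Fin n with levelCount α β ≤ i.val, ∑ j : Fin n with levelCount α β ≤ j.val,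
            h i * h j * (min (α i) (α j) - α i * α j) := by
  set k := levelCount α β with hk
  have hT : ∀ i : Fin n, i ∈ Finset.univ.filter (fun i : Fin n => i.val < k) → β ≤ α i :=
    fun i hi => (lt_levelCount_iff hanti β i).mp (Finset.mem_filter.mp hi).2
  have hL : ∀ i : Fin n, i ∈ Finset.univ.filter (fun i : Fin n => k ≤ i.val) → α i ≤ β :=
    fun i hi => by
      by_contra! hlt
      exact (Finset.mem_filter.mp hi).2.not_gt ((lt_levelCount_iff hanti β i).mpr hlt.le)
  have split : ∀ f : Fin n → ℝ, ∑ i, f i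
      = ∑ i : Fin n with i.val < k, f i + ∑ i : Fin n with k ≤ i.val, f i := fun f => by
    rw [← Finset.sum_filter_add_sum_filter_not Finset.univ (fun i : Fin n => i.val < k)]
    simp
  have htail := one_sub_cumGain_mul_tailAvg (α := α) hpos hsum k
  have block : ∀ (s t : Finset (Fin n)) (f : Fin n → Fin n → ℝ) (x y : Fin n → ℝ),
      (∀ i ∈ s, ∀ j ∈ t, f i j = x i * y j) → ∑ i ∈ s, ∑ j ∈ t, f i j
        = (∑ i ∈ s, x i) * ∑ j ∈ t, y j := fun s t f x y hf => by
    rw [Finset.sum_mul_sum]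
    exact Finset.sum_congr rfl fun i hi => Finset.sum_congr rfl fun j hj => hf i hi j hj
  unfold VmaxE
  rw [split]
  simp_rw [fun i => split fun j =>
    h i * h j * (min (min β (α i)) (min β (α j)) - min β (α i) * min β (α j))]
  rw [Finset.sum_add_distrib, Finset.sum_add_distrib,
    block _ _ _ h (fun j => h j * (β * (1 - β))) fun i hi j hj => by
      rw [min_eq_left (hT i hi), min_eq_left (hT j hj), min_self]; ring,
    block _ _ _ h (fun j => h j * α j * (1 - β)) fun i hi j hj => by
      rw [min_eq_left (hT i hi), min_eq_right (hL j hj), min_eq_right (hL j hj)]; ring,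
    block _ _ _ (fun i => h i * α i * (1 - β)) h fun i hi j hj => by
      rw [min_eq_left (hT j hj), min_eq_right (hL i hi), min_eq_left (hL i hi)]; ring,
    ← Finset.sum_mul, ← Finset.sum_mul, ← htail]
  have hLL : ∑ i : Fin n with k ≤ i.val, ∑ j : Fin n with k ≤ j.val,
        h i * h j * (min (min β (α i)) (min β (α j)) - min β (α i) * min β (α j))
      = ∑ i : Fin n with k ≤ i.val, ∑ j : Fin n with k ≤ j.val,
        h i * h j * (min (α i) (α j) - α i * α j) :=
    Finset.sum_congr rfl fun i hi => Finset.sum_congr rfl fun j hj => by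
      rw [min_eq_right (hL i hi), min_eq_right (hL j hj)]
  rw [hLL, cumGain]
  ring

/-- The switching property of `betaStar`: `H(u) - 2 m(u)`, with `H(u)` the total gain of the levels
at least `u` and `m(u)` the mean of `S` for the means `min u α`, is nonincreasing in `u` and changes
sign at `betaStar`. -/
lemma betaStar_spec (hn : 2 ≤ n) (hα : ∀ k, α k ∈ Set.Icc (0 : ℝ) 1) (hanti : StrictAnti α)
    (hpos : ∀ k, 0 < h k) (hsum : ∑ k, h k = 1) (hlast_half : α ⟨n - 1, by omega⟩ ≤ 1 / 2) :
    α ⟨n - 1, by omega⟩ ≤ betaStar hn h α ∧ betaStar hn h α ≤ α ⟨0, by omega⟩ ∧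
    (∀ u < betaStar hn h α, 2 * equivInput h (fun k => min (betaStar hn h α) (α k))
      ≤ equivInput h (nestedInput α u)) ∧
    (∀ u, betaStar hn h α < u → equivInput h (nestedInput α u)
      ≤ 2 * equivInput h (fun k => min (betaStar hn h α) (α k))) := by
  set A := α ⟨n - 1, by omega⟩ with hA
  set B := α ⟨0, by omega⟩ with hB
  set b := betaStar hn h α with hb
  have hAB : A ≤ B := hanti.antitone (by simp)
  have hAmin : ∀ k, A ≤ α k := fun k => hanti.antitone (by
    rw [Fin.le_def]; have := k.2; simp only; omega)
  have hBmax : ∀ k, α k ≤ B := fun k => hanti.antitone (by simp [Fin.le_def])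
  have hlow : ∀ x ∈ insert B (levelSet hn h α), A ≤ x := by
    rintro x (rfl | hx)
    · exact hAB
    · exact hx.1.1.le
  have hbdd : BddBelow (insert B (levelSet hn h α)) := ⟨A, hlow⟩
  have hAb : A ≤ b := le_csInf (Set.insert_nonempty _ _) hlow
  have hbB : b ≤ B := csInf_le hbdd (Set.mem_insert _ _)
  have hmono : Monotone fun β : ℝ => equivInput h (fun k => min β (α k)) := fun x y hxy =>
    Finset.sum_le_sum fun k _ =>
      mul_le_mul_of_nonneg_left (min_le_min_right _ hxy) (hpos k).le
  have hcont : Continuous fun β : ℝ => 2 * equivInput h (fun k => min β (α k)) := by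
    unfold equivInput
    fun_prop
  refine ⟨hAb, hbB, fun u hu => ?_, fun u hu => ?_⟩
  · rcases hAb.eq_or_lt with hAb | hAb
    · -- Every level is at least `A = b`, so the gain is `1` and the capped mean is `A ≤ 1 / 2`.
      have h1 : equivInput h (nestedInput α u) = 1 := by
        rw [← hsum]
        refine Finset.sum_congr rfl fun k _ => ?_
        simp [nestedInput, hu.le.trans (hAb.symm.le.trans (hAmin k))]
      have h2 : equivInput h (fun k => min b (α k)) = A := by
        have : ∀ k, min b (α k) = A := fun k => by rw [← hAb, min_eq_left (hAmin k)]
        simp only [equivInput, this, ← Finset.sum_mul, hsum, one_mul]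
      rw [h1, h2]
      linarith
    · have hev : ∀ᶠ v in nhdsWithin b (Set.Iio b),
          2 * equivInput h (fun k => min v (α k)) ≤ equivInput h (nestedInput α u) := by
        filter_upwards [Ioo_mem_nhdsLT (max_lt hu hAb)] with v hv
        have hvn : v ∉ levelSet hn h α := fun hmem =>
          (csInf_le hbdd (Set.mem_insert_of_mem _ hmem)).not_gt hv.2
        rw [mem_levelSet_iff hn hanti hpos hsum, not_and, not_le] at hvn
        have h1 := hvn ⟨(le_max_right _ _).trans_lt hv.1, (hv.2.le.trans hbB)⟩
        exact h1.le.trans (equivInput_nestedInput_mono hpos ((le_max_left _ _).trans hv.1.le)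
          fun _ => le_rfl)
      exact le_of_tendsto ((hcont.tendsto b).mono_left nhdsWithin_le_nhds) hev
  · rcases lt_or_ge B u with hBu | hBu
    · have h1 : equivInput h (nestedInput α u) = 0 := by
        refine Finset.sum_eq_zero fun k _ => ?_
        simp [nestedInput, (hBmax k).trans_lt hBu]
      rw [h1]
      refine mul_nonneg zero_le_two (Finset.sum_nonneg fun k _ => mul_nonneg (hpos k).le ?_)
      exact le_min ((hα _).1.trans hAb) (hα k).1
    · have hev : ∀ᶠ v in nhdsWithin b (Set.Ioi b),
          equivInput h (nestedInput α u) ≤ 2 * equivInput h (fun k => min v (α k)) := by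
        filter_upwards [Ioo_mem_nhdsGT hu] with v hv
        obtain ⟨w, hw, hwv⟩ := exists_lt_of_csInf_lt (Set.insert_nonempty _ _) hv.1
        rcases hw with rfl | hw
        · exact absurd (hwv.trans hv.2) hBu.not_gt
        · rw [mem_levelSet_iff hn hanti hpos hsum] at hw
          refine (equivInput_nestedInput_mono hpos (hwv.trans hv.2).le fun _ => le_rfl).trans
            (hw.2.trans ?_)
          exact mul_le_mul_of_nonneg_left (hmono hwv.le) zero_le_two
      exact ge_of_tendsto ((hcont.tendsto b).mono_left nhdsWithin_le_nhds) hev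

end OIC

theorem theorem6 (n : ℕ) (hn : 2 ≤ n) (h α : Fin n → ℝ) (σ : ℝ)
    (hpos : ∀ k, 0 < h k) (hsum : ∑ k, h k = 1)
    (hα : ∀ k, α k ∈ Set.Icc (0 : ℝ) 1) (hanti : StrictAnti α)
    (hlast_pos : 0 < α ⟨n - 1, by omega⟩) (hlast_half : α ⟨n - 1, by omega⟩ ≤ 1 / 2)
    (hσ : 0 < σ) :
    OIC.capacityBC h α σ
        ≤ ENNReal.ofReal (1 / 2 * Real.log (1 + OIC.VmaxB hn h α / σ ^ 2)) ∧
      IsGreatest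
        {v : ℝ | ∃ P : MeasureTheory.Measure (Fin n → ℝ), OIC.IsFeasibleBC α P ∧
          v = ProbabilityTheory.variance (OIC.equivInput h) P}
        (OIC.VmaxB hn h α) ∧
      OIC.betaStar hn h α ∈ Set.Icc (0 : ℝ) (α ⟨0, by omega⟩) ∧
      OIC.VmaxB hn h α = OIC.VmaxE h (fun k => min (OIC.betaStar hn h α) (α k)) ∧
      IsMaxOn (fun β : ℝ => OIC.VmaxE h (fun k => min β (α k)))
        (Set.Icc (0 : ℝ) (α ⟨0, by omega⟩)) (OIC.betaStar hn h α) := by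
  obtain ⟨hAb, hbB, hlt, hgt⟩ := OIC.betaStar_spec hn hα hanti hpos hsum hlast_half
  have hb0 : 0 ≤ OIC.betaStar hn h α := hlast_pos.le.trans hAb
  have hVB : OIC.VmaxB hn h α = OIC.VmaxE h (fun k => min (OIC.betaStar hn h α) (α k)) :=
    (OIC.VmaxE_min hanti hpos hsum _).symm
  have hopt : ∀ a : Fin n → ℝ, (∀ k, 0 ≤ a k) → (∀ k, a k ≤ α k) →
      OIC.VmaxE h a ≤ OIC.VmaxB hn h α := fun a ha haα =>
    hVB ▸ OIC.VmaxE_le_VmaxE_min hpos hα hb0 hlt hgt ha haα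
  have hvar : ∀ P, OIC.IsFeasibleBC α P → variance (OIC.equivInput h) P ≤ OIC.VmaxB hn h α :=
    fun P hP => (hP.variance_le_VmaxE hpos).trans (hopt _ hP.mean_nonneg hP.average)
  refine ⟨iSup₂_le fun P hP => ?_, ⟨?_, ?_⟩, ⟨hb0, hbB⟩, hVB, fun β hβ => ?_⟩
  · have := hP.isProb
    have hV0 : 0 ≤ variance (OIC.equivInput h) P := variance_nonneg _ _
    refine (OIC.mutualInfo_jointLaw_le hσ hP.memLp_equivInput).trans (ENNReal.ofReal_le_ofReal ?_)
    have hle := hvar P hP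
    gcongr
  · have hb1 : ∀ k, min (OIC.betaStar hn h α) (α k) ∈ Set.Icc (0 : ℝ) 1 := fun k =>
      ⟨le_min hb0 (hα k).1, (min_le_right _ _).trans (hα k).2⟩
    exact ⟨_, OIC.isFeasibleBC_map_nestedInput hb1 fun k => min_le_right _ _,
      hVB.trans (OIC.variance_map_nestedInput hb1).symm⟩
  · rintro v ⟨P, hP, rfl⟩
    exact hvar P hP
  · exact (hopt _ (fun k => le_min hβ.1 (hα k).1) fun k => min_le_right _ _).trans_eq hVB
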